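/- Let $E$ be a separable real Banach space with its Borel $\sigma$-algebra $\mathcal B(E)$, let $(\Omega,\mathcal F,\mathbf P)$ be a complete probability space, and let $\mathcal H\subset\mathcal F$ be a sub-$\sigma$-algebra. For a $\sigma$-algebra $\mathcal G\subset\mathcal F$, a $\mathcal G$-measurable random set is a map $X$ from $\Omega$ to the subsets of $E$ (possibly empty) whose graph $\{(\omega,x): x\in X(\omega)\}$ belongs to $\mathcal G\otimes\mathcal B(E)$; a random set is an $\mathcal F$-measurable one. It is called closed (convex) if $X(\omega)$ is closed (convex) for almost all $\omega$. For a set-valued map $X$, the conditional convex hull $\mathbf M(X|\mathcal H)$ is the smallest, with respect to almost sure inclusion, $\mathcal H$-measurable random convex closed set that almost surely contains $X$; it is unique up to almost sure equality. Sums of sets are pointwise, $(X+Y)(\omega)=\{x+y: x\in X(\omega),\,y\in Y(\omega)\}$, and $\operatorname{cl}$ is the norm closure, taken for each $\omega$. Let $X$ and $Y$ be random sets in $E$. Then $\mathbf M(X|\mathcal H)$, $\mathbf M(Y|\mathcal H)$ and $\mathbf M(X+Y|\mathcal H)$ exist, and $$\mathbf M(X+Y|\mathcal H)\subset\operatorname{cl}\bigl(\mathbf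 M(X|\mathcal H)+\mathbf M(Y|\mathcal H)\bigr)\quad\text{almost surely.}$$ If, moreover, $Y$ is $\mathcal H$-measurable and convex, then $$\mathbf M(X+Y|\mathcal H)=\operatorname{cl}\bigl(\mathbf M(X|\mathcal H)+Y\bigr)\quad\text{almost surely.}$$ -/

import Mathlib

open MeasureTheory
open scoped Pointwise

/-- `X` is an `m`-measurable random set: its graph `{(ω, x) | x ∈ X ω}` belongs to the product
of the σ-algebra `m` and the σ-algebra of the space of values (graph measurability). The values
need not be closed, convex or non-empty. -/
def IsRandomSet {Ω E : Type*} [MeasurableSpace E] (m : MeasurableSpace Ω) (X : Ω → Set E) : Prop :=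
  MeasurableSet[m.prod inferInstance] {p : Ω × E | p.2 ∈ X p.1}

/-- `C` is an `H`-measurable random convex closed set: it is graph measurable with respect to `H`,
and almost all of its values are closed and convex (possibly empty). -/
structure IsRandomConvexClosed {Ω E : Type*} [NormedAddCommGroup E] [NormedSpace ℝ E]
    [MeasurableSpace E] (H : MeasurableSpace Ω) {mΩ : MeasurableSpace Ω} (P : Measure Ω)
    (C : Ω → Set E) : Prop where
  measurable : IsRandomSet H C
  closed : ∀ᵐ ω ∂P, IsClosed (C ω)
  convex : ∀ᵐ ω ∂P, Convex ℝ (C ω)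

/-- `M` is (a version of) the conditional convex hull of `X` given `H`: the smallest, for almost
sure inclusion, `H`-measurable random convex closed set which almost surely contains `X`.
It is unique up to almost sure equality. -/
structure IsCondConvexHull {Ω E : Type*} [NormedAddCommGroup E] [NormedSpace ℝ E]
    [MeasurableSpace E] (H : MeasurableSpace Ω) {mΩ : MeasurableSpace Ω} (P : Measure Ω)
    (X M : Ω → Set E) : Prop where
  convexClosed : IsRandomConvexClosed H P M
  contains : ∀ᵐ ω ∂P, X ω ⊆ M ω
  smallest : ∀ C : Ω → Set E, IsRandomConvexClosed H P C →
    (∀ᵐ ω ∂P, X ω ⊆ C ω) → ∀ᵐ ω ∂P, M ω ⊆ C ω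

/-! ### Universal measurability of analytic sets -/

/-! Random sets are handled through their hitting events {S ∩ U ≠ ∅}, U open. A hitting event is the
projection of a measurable set, so for an `H`-measurable S it lies in `H` up to a null set, by the
measurable projection theorem (proved from the capacitability of analytic sets). Conversely, the
hits of a countable base determine the closure of S as a random set.

The hull exists because the competitors are stable under countable intersections: for each basic U
some competitor avoids U with maximal probability, and the intersection of these is minimal.

For the inclusion, cl(M(X|H) + M(Y|H)) is a competitor for X + Y. For the reverse one, the set of x
with x + Y ⊆ M(X+Y|H) is an intersection of translates of a closed convex set; it is `H`-measurable
and contains X, hence contains M(X|H). -/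

theorem isCompact_Iic_nat (k : ℕ → ℕ) : IsCompact (Set.Iic k) := by
  rw [← Set.Icc_bot]
  exact isCompact_Icc

/-- The compact set of sequences dominated by `k` is, as far as open neighbourhoods are concerned,
described by finitely many coordinates. -/
theorem exists_forall_lt_le_subset_of_isOpen {k : ℕ → ℕ} {U : Set (ℕ → ℕ)} (hU : IsOpen U)
    (hk : Set.Iic k ⊆ U) : ∃ n, {σ : ℕ → ℕ | ∀ i < n, σ i ≤ k i} ⊆ U := by
  let _ : MetricSpace (ℕ → ℕ) := PiNat.metricSpaceNatNat
  obtain ⟨δ, hδ, hsub⟩ := (isCompact_Iic_nat k).exists_thickening_subset_open hU hk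
  obtain ⟨n, hn⟩ := exists_pow_lt_of_lt_one hδ (show (1 / 2 : ℝ) < 1 by norm_num)
  refine ⟨n, fun σ hσ => hsub ?_⟩
  -- Truncating `σ` at `k` gives a point of `Set.Iic k` with the same first `n` coordinates, hence
  -- at distance at most `(1 / 2) ^ n`.
  refine Metric.mem_thickening_iff.2 ⟨fun i => min (σ i) (k i), fun i => min_le_right _ _, ?_⟩
  refine lt_of_le_of_lt ?_ hn
  refine PiNat.mem_cylinder_iff_dist_le.1 ?_
  intro i hi
  exact (min_eq_left (hσ i hi)).symm

/-- Analytic sets are measurable up to null sets of every finite Borel measure. -/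
theorem MeasureTheory.AnalyticSet.nullMeasurableSet {α : Type*} [TopologicalSpace α]
    [TopologicalSpace.PseudoMetrizableSpace α] [T2Space α] [MeasurableSpace α] [BorelSpace α]
    {s : Set α} (hs : AnalyticSet s) (μ : Measure α) [IsFiniteMeasure μ] :
    NullMeasurableSet s μ := by
  rw [AnalyticSet] at hs
  rcases hs with rfl | ⟨g, hg, rfl⟩
  · exact nullMeasurableSet_empty
  -- Inner approximation by compact sets: bound the coordinates one at a time, keeping the outer
  -- measure of the image above `c`. Continuity from below along increasing unions needs no
  -- measurability of the images.
  have key : ∀ c < μ (Set.range g), ∃ t ⊆ Set.range g, MeasurableSet t ∧ c ≤ μ t := by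
    intro c hc
    let T : ℕ → (ℕ → ℕ) → Set (ℕ → ℕ) := fun n k => {σ | ∀ i < n, σ i ≤ k i}
    have step : ∀ n k, c < μ (g '' T n k) → ∃ j, c < μ (g '' (T n k ∩ {σ | σ n ≤ j})) := by
      intro n k h
      have hU : g '' T n k = ⋃ j, g '' (T n k ∩ {σ | σ n ≤ j}) := by
        rw [← Set.image_iUnion, ← Set.inter_iUnion]
        congr 1
        refine (Set.inter_eq_left.2 fun σ _ => Set.mem_iUnion.2 ⟨σ n, le_refl (σ n)⟩).symm
      have hmono : Monotone fun j => g '' (T n k ∩ {σ : ℕ → ℕ | σ n ≤ j}) := fun a b hab =>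
        Set.image_mono (Set.inter_subset_inter_right _ fun σ (hσ : σ n ≤ a) => hσ.trans hab)
      rw [hU, hmono.measure_iUnion] at h
      exact lt_iSup_iff.1 h
    have step' : ∀ n k, ∃ j, c < μ (g '' T n k) → c < μ (g '' (T n k ∩ {σ | σ n ≤ j})) := by
      intro n k
      by_cases h : c < μ (g '' T n k)
      · obtain ⟨j, hj⟩ := step n k h
        exact ⟨j, fun _ => hj⟩
      · exact ⟨0, fun h' => absurd h' h⟩
    choose J hJ using step'
    let F : ℕ → ℕ → ℕ := fun n => Nat.rec (fun _ => 0) (fun n k => Function.update k n (J n k)) n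
    have hF : ∀ n, F (n + 1) = Function.update (F n) n (J n (F n)) := fun n => rfl
    have hFc : ∀ n, c < μ (g '' T n (F n)) := by
      intro n
      induction n with
      | zero => simpa [T] using hc
      | succ n ih =>
        refine (hJ n _ ih).trans_le (measure_mono (Set.image_mono ?_))
        rintro σ ⟨h1, h2⟩ i hi
        rw [hF]
        rcases Nat.lt_succ_iff_lt_or_eq.1 hi with h | rfl
        · rw [Function.update_of_ne h.ne]
          exact h1 i h
        · simpa using h2
    have hstab : ∀ i n, i < n → F n i = F (i + 1) i := by
      intro i n hn
      induction n, hn using Nat.le_induction with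
      | base => rfl
      | succ n hn ih =>
        rw [hF, Function.update_of_ne (by omega), ih]
    let k : ℕ → ℕ := fun i => F (i + 1) i
    have hk : ∀ n, c < μ (g '' T n k) := by
      intro n
      have : T n k = T n (F n) := by
        ext σ
        refine forall₂_congr fun i hi => ?_
        rw [hstab i n hi]
      rw [this]
      exact hFc n
    refine ⟨g '' Set.Iic k, Set.image_subset_range _ _,
      ((isCompact_Iic_nat k).image hg).measurableSet, ?_⟩
    -- By outer regularity it suffices to bound open `V` around the compact image; such a `V`
    -- already contains some `g '' T n k`.
    rw [Set.measure_eq_iInf_isOpen]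
    refine le_iInf₂ fun V hV => le_iInf fun hVo => ?_
    obtain ⟨n, hn⟩ := exists_forall_lt_le_subset_of_isOpen (hVo.preimage hg)
      (Set.image_subset_iff.1 hV)
    exact (hk n).le.trans (measure_mono (Set.image_subset_iff.2 hn))
  rcases eq_or_ne (μ (Set.range g)) 0 with h0 | h0
  · exact NullMeasurableSet.of_null h0
  obtain ⟨c, -, hc, hlim⟩ := exists_seq_strictMono_tendsto' (pos_iff_ne_zero.2 h0)
  choose t hts htm hct using fun n => key (c n) (hc n).2
  have hsub : (⋃ n, t n) ⊆ Set.range g := Set.iUnion_subset hts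
  have hm : NullMeasurableSet (⋃ n, t n) μ := (MeasurableSet.iUnion htm).nullMeasurableSet
  refine hm.congr (ae_eq_of_subset_of_measure_ge hsub ?_ hm (measure_ne_top _ _))
  exact le_of_tendsto' hlim fun n => (hct n).trans (measure_mono (Set.subset_iUnion t n))

/-! ### Measurable projections -/

/-- A set in a product σ-algebra depends on the first coordinate only through a measurable map to
the Cantor space. -/
theorem MeasurableSet.exists_preimage_prodMap_cantor {Ω E : Type*} [MeasurableSpace Ω]
    [MeasurableSpace E] {A : Set (Ω × E)} (hA : MeasurableSet A) :
    ∃ (f : Ω → ℕ → Bool) (B : Set ((ℕ → Bool) × E)), Measurable f ∧ MeasurableSet B ∧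
      A = Prod.map f id ⁻¹' B := by
  classical
  induction A, hA using MeasurableSpace.induction_on_inter generateFrom_prod.symm
    isPiSystem_prod with
  | empty => exact ⟨fun _ _ => false, ∅, measurable_const, .empty, rfl⟩
  | basic t ht =>
    obtain ⟨s, hs, u, hu, rfl⟩ := ht
    refine ⟨fun ω _ => decide (ω ∈ s), {c | c 0 = true} ×ˢ u, ?_, ?_, ?_⟩
    · refine measurable_pi_iff.2 fun _ => measurable_to_bool ?_
      simpa [Set.preimage] using hs
    · refine MeasurableSet.prod ?_ hu
      exact measurable_pi_apply (X := fun _ : ℕ => Bool) 0 (measurableSet_singleton true)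
    · ext ⟨ω, x⟩
      simp
  | compl t _ ih =>
    obtain ⟨f, B, hf, hB, rfl⟩ := ih
    exact ⟨f, Bᶜ, hf, hB.compl, rfl⟩
  | iUnion t _ _ ih =>
    choose f B hf hB ht using ih
    -- The pairing function interleaves countably many Cantor codes into one.
    refine ⟨fun ω k => f k.unpair.1 ω k.unpair.2,
      ⋃ n, Prod.map (fun c m => c (Nat.pair n m)) id ⁻¹' B n, ?_, ?_, ?_⟩
    · exact measurable_pi_iff.2 fun k => (measurable_pi_apply _).comp (hf _)
    · refine MeasurableSet.iUnion fun n => ?_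
      refine (Measurable.prodMap ?_ measurable_id) (hB n)
      exact measurable_pi_iff.2 fun k => measurable_pi_apply _
    · rw [Set.preimage_iUnion]
      refine Set.iUnion_congr fun n => ?_
      rw [ht n]
      ext ⟨ω, x⟩
      simp

/-- **Measurable projection theorem**, up to null sets. -/
theorem MeasurableSet.nullMeasurableSet_image_fst {Ω E : Type*} [MeasurableSpace Ω]
    [TopologicalSpace E] [PolishSpace E] [MeasurableSpace E] [BorelSpace E]
    {A : Set (Ω × E)} (hA : MeasurableSet A) (μ : Measure Ω) [IsFiniteMeasure μ] :
    NullMeasurableSet (Prod.fst '' A) μ := by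
  obtain ⟨f, B, hf, hB, rfl⟩ := hA.exists_preimage_prodMap_cantor
  have h : Prod.fst '' (Prod.map f id ⁻¹' B) = f ⁻¹' (Prod.fst '' B) := by
    ext ω
    simp
  rw [h]
  have hB' : AnalyticSet (Prod.fst '' B) := hB.analyticSet_image measurable_fst
  exact (hB'.nullMeasurableSet (μ.map f)).preimage
    (hf.measurePreserving μ).quasiMeasurePreserving

theorem TopologicalSpace.IsTopologicalBasis.exists_add_subset {E : Type*} [TopologicalSpace E]
    [Add E] [ContinuousAdd E] {b : Set (Set E)} (hb : IsTopologicalBasis b) {U : Set E}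
    (hU : IsOpen U) {x y : E} (hxy : x + y ∈ U) :
    ∃ V W, V ∈ b ∧ W ∈ b ∧ x ∈ V ∧ y ∈ W ∧ V + W ⊆ U := by
  have h : (fun p : E × E => p.1 + p.2) ⁻¹' U ∈ nhds (x, y) :=
    (hU.preimage continuous_add).mem_nhds hxy
  obtain ⟨V', hV', W', hW', hsub⟩ := mem_nhds_prod_iff.1 h
  obtain ⟨V, hV, hxV, hVV⟩ := hb.mem_nhds_iff.1 hV'
  obtain ⟨W, hW, hyW, hWW⟩ := hb.mem_nhds_iff.1 hW'
  refine ⟨V, W, hV, hW, hxV, hyW, ?_⟩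
  rintro _ ⟨v, hv, w, hw, rfl⟩
  exact hsub (Set.mk_mem_prod (hVV hv) (hWW hw))

/-! ### Hitting events of set-valued maps -/

/-- The hitting events of open sets by the set-valued map `S` belong, up to null sets, to the
σ-algebra `m`. -/
def HasMeasurableHits {Ω E : Type*} [TopologicalSpace E] (m : MeasurableSpace Ω)
    {mΩ : MeasurableSpace Ω} (P : Measure Ω) (S : Ω → Set E) : Prop :=
  ∀ U : Set E, IsOpen U → ∃ A, MeasurableSet[m] A ∧ ∀ᵐ ω ∂P, ω ∈ A ↔ (S ω ∩ U).Nonempty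

section Hits

variable {Ω E : Type*} [NormedAddCommGroup E]
  {H : MeasurableSpace Ω} [mΩ : MeasurableSpace Ω] {P : Measure Ω}

theorem IsRandomSet.hasMeasurableHits [CompleteSpace E] [TopologicalSpace.SeparableSpace E]
    [MeasurableSpace E] [BorelSpace E] {S : Ω → Set E} (hS : IsRandomSet H S)
    (hH : H ≤ mΩ) [IsFiniteMeasure P] :
    HasMeasurableHits H P S := by
  intro U hU
  have : SecondCountableTopology E := UniformSpace.secondCountable_of_separable E
  have hA : MeasurableSet[H.prod inferInstance] ({p : Ω × E | p.2 ∈ S p.1} ∩ Prod.snd ⁻¹' U) :=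
    MeasurableSet.inter hS (@measurable_snd Ω E H _ _ hU.measurableSet)
  -- Projecting with respect to the trimmed measure makes the approximating event `B` belong to `H`,
  -- not merely to the ambient σ-algebra.
  obtain ⟨B, hB, hBe⟩ :=
    (@MeasurableSet.nullMeasurableSet_image_fst Ω E H _ _ _ _ _ hA (P.trim hH) _)
  refine ⟨B, hB, ?_⟩
  filter_upwards [ae_eq_of_ae_eq_trim hBe] with ω hω
  have h1 : ω ∈ B ↔ ω ∈ Prod.fst '' ({p : Ω × E | p.2 ∈ S p.1} ∩ Prod.snd ⁻¹' U) :=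
    (iff_of_eq hω).symm
  rw [h1]
  simp [Set.Nonempty]

open TopologicalSpace in
-- By continuity of addition, the sum hits `U` exactly when, for one of countably many basic pairs
-- with `V + W ⊆ U`, `S` hits `V` and `T` hits `W`.
theorem HasMeasurableHits.add [SecondCountableTopology E] {S T : Ω → Set E}
    (hS : HasMeasurableHits H P S) (hT : HasMeasurableHits H P T) :
    HasMeasurableHits H P (fun ω => S ω + T ω) := by
  intro U hU
  choose! A hA hAe using hS
  choose! B hB hBe using hT
  have hb := isBasis_countableBasis E
  let I : Set (Set E × Set E) :=
    {p ∈ countableBasis E ×ˢ countableBasis E | p.1 + p.2 ⊆ U}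
  have hI : I.Countable :=
    ((countable_countableBasis E).prod (countable_countableBasis E)).mono fun p hp => hp.1
  have hIo : ∀ p ∈ I, IsOpen p.1 ∧ IsOpen p.2 := fun p hp =>
    ⟨hb.isOpen hp.1.1, hb.isOpen hp.1.2⟩
  refine ⟨⋃ p ∈ I, A p.1 ∩ B p.2, ?_, ?_⟩
  · exact MeasurableSet.biUnion hI fun p hp =>
      (hA _ (hIo p hp).1).inter (hB _ (hIo p hp).2)
  · have h1 := (ae_ball_iff hI).2 fun p hp => hAe p.1 (hIo p hp).1
    have h2 := (ae_ball_iff hI).2 fun p hp => hBe p.2 (hIo p hp).2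
    filter_upwards [h1, h2] with ω h1 h2
    simp only [Set.mem_iUnion, Set.mem_inter_iff]
    constructor
    · rintro ⟨p, hp, ha, hb⟩
      obtain ⟨x, hx, hxp⟩ := (h1 p hp).1 ha
      obtain ⟨y, hy, hyp⟩ := (h2 p hp).1 hb
      exact ⟨x + y, Set.add_mem_add hx hy, hp.2 (Set.add_mem_add hxp hyp)⟩
    · rintro ⟨_, ⟨x, hx, y, hy, rfl⟩, hxy⟩
      obtain ⟨V, W, hV, hW, hxV, hyW, hVW⟩ := hb.exists_add_subset hU hxy
      have hp : (V, W) ∈ I := ⟨⟨hV, hW⟩, hVW⟩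
      exact ⟨(V, W), hp, (h1 _ hp).2 ⟨x, hx, hxV⟩, (h2 _ hp).2 ⟨y, hy, hyW⟩⟩

open TopologicalSpace in
/-- The closure of a set-valued map with measurable hitting events is almost surely equal to a
random closed set. -/
theorem HasMeasurableHits.exists_isRandomSet_ae_eq_closure [SecondCountableTopology E]
    [MeasurableSpace E] [BorelSpace E]
    {S : Ω → Set E} (hS : HasMeasurableHits H P S) :
    ∃ C, IsRandomSet H C ∧ ∀ᵐ ω ∂P, C ω = closure (S ω) := by
  choose! A hA hAe using hS
  have hb := isBasis_countableBasis E
  refine ⟨fun ω => {x | ∀ U ∈ countableBasis E, x ∈ U → ω ∈ A U}, ?_, ?_⟩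
  · have : {p : Ω × E | ∀ U ∈ countableBasis E, p.2 ∈ U → p.1 ∈ A U} =
        ⋂ U ∈ countableBasis E, (Prod.snd ⁻¹' U)ᶜ ∪ Prod.fst ⁻¹' A U := by
      ext p
      simp [imp_iff_not_or]
    unfold IsRandomSet
    simp only [Set.mem_ofPred_eq]
    rw [this]
    refine MeasurableSet.biInter (countable_countableBasis E) fun U hU => ?_
    exact (measurable_snd (hb.isOpen hU).measurableSet).compl.union
      (measurable_fst (hA U (hb.isOpen hU)))
  · filter_upwards [(ae_ball_iff (countable_countableBasis E)).2
      fun U hU => hAe U (hb.isOpen hU)] with ω hω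
    ext x
    rw [hb.mem_closure_iff]
    refine forall₃_congr fun U hU hx => ?_
    rw [hω U hU, Set.inter_comm]

open TopologicalSpace in
/-- The set of translations mapping `S` into the closure of `T` is almost surely equal to a random
set. -/
theorem HasMeasurableHits.exists_isRandomSet_ae_eq_translations [SecondCountableTopology E]
    [MeasurableSpace E] [BorelSpace E] {S T : Ω → Set E}
    (hS : HasMeasurableHits H P S) (hT : HasMeasurableHits H P T) :
    ∃ C, IsRandomSet H C ∧ ∀ᵐ ω ∂P, C ω = {x | ∀ y ∈ S ω, x + y ∈ closure (T ω)} := by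
  choose! A hA hAe using hS
  choose! B hB hBe using hT
  have hb := isBasis_countableBasis E
  let I : Set (Set E × Set E × Set E) :=
    {p ∈ countableBasis E ×ˢ countableBasis E ×ˢ countableBasis E | p.1 + p.2.1 ⊆ p.2.2}
  have hI : I.Countable := ((countable_countableBasis E).prod
    ((countable_countableBasis E).prod (countable_countableBasis E))).mono fun p hp => hp.1
  have hIo : ∀ p ∈ I, IsOpen p.1 ∧ IsOpen p.2.1 ∧ IsOpen p.2.2 := fun p hp =>
    ⟨hb.isOpen hp.1.1, hb.isOpen hp.1.2.1, hb.isOpen hp.1.2.2⟩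
  -- For `V + W ⊆ U` with `x ∈ V`: if `S` hits `W`, then `T` must hit `U`.
  refine ⟨fun ω => {x | ∀ p ∈ I, x ∈ p.1 → ω ∈ A p.2.1 → ω ∈ B p.2.2}, ?_, ?_⟩
  · have : {q : Ω × E | ∀ p ∈ I, q.2 ∈ p.1 → q.1 ∈ A p.2.1 → q.1 ∈ B p.2.2} =
        ⋂ p ∈ I, (Prod.snd ⁻¹' p.1)ᶜ ∪ Prod.fst ⁻¹' ((A p.2.1)ᶜ ∪ B p.2.2) := by
      ext q
      simp only [imp_iff_not_or, Set.mem_ofPred_eq, Set.mem_iInter, Set.mem_union, Set.mem_compl_iff,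
        Set.mem_preimage]
    unfold IsRandomSet
    simp only [Set.mem_ofPred_eq]
    rw [this]
    refine MeasurableSet.biInter hI fun p hp => ?_
    obtain ⟨h1, h2, h3⟩ := hIo p hp
    exact (measurable_snd h1.measurableSet).compl.union
      (measurable_fst ((hA _ h2).compl.union (hB _ h3)))
  · have h1 := (ae_ball_iff hI).2 fun p hp => hAe p.2.1 (hIo p hp).2.1
    have h2 := (ae_ball_iff hI).2 fun p hp => hBe p.2.2 (hIo p hp).2.2
    filter_upwards [h1, h2] with ω h1 h2
    ext x
    simp only [Set.mem_ofPred_eq]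
    constructor
    · intro h y hy
      rw [hb.mem_closure_iff]
      intro U hU hxy
      obtain ⟨V, W, hV, hW, hxV, hyW, hVW⟩ := hb.exists_add_subset (hb.isOpen hU) hxy
      have hp : (V, W, U) ∈ I := ⟨⟨hV, hW, hU⟩, hVW⟩
      rw [Set.inter_comm]
      exact (h2 _ hp).1 (h _ hp hxV ((h1 _ hp).2 ⟨y, hy, hyW⟩))
    · intro h p hp hxp hA
      obtain ⟨y, hy, hyp⟩ := (h1 p hp).1 hA
      refine (h2 p hp).2 ?_
      rw [Set.inter_comm]
      exact mem_closure_iff.1 (h y hy) _ (hIo p hp).2.2 (hp.2 (Set.add_mem_add hxp hyp))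

end Hits

/-! ### Conditional convex hulls -/

section Hull

variable {Ω E : Type*} [NormedAddCommGroup E] [NormedSpace ℝ E] [MeasurableSpace E]
  {H : MeasurableSpace Ω} [mΩ : MeasurableSpace Ω] {P : Measure Ω}

theorem IsRandomConvexClosed.iInter {ι : Type*} [Countable ι] {C : ι → Ω → Set E}
    (hC : ∀ i, IsRandomConvexClosed H P (C i)) :
    IsRandomConvexClosed H P (fun ω => ⋂ i, C i ω) where
  measurable := by
    have : {p : Ω × E | p.2 ∈ ⋂ i, C i p.1} = ⋂ i, {p : Ω × E | p.2 ∈ C i p.1} := by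
      ext p
      simp
    unfold IsRandomSet
    rw [this]
    exact MeasurableSet.iInter fun i => (hC i).measurable
  closed := by
    filter_upwards [ae_all_iff.2 fun i => (hC i).closed] with ω hω using isClosed_iInter hω
  convex := by
    filter_upwards [ae_all_iff.2 fun i => (hC i).convex] with ω hω using convex_iInter hω

variable [BorelSpace E]

/-- Every set-valued map has a conditional convex hull. -/
theorem exists_isCondConvexHull [CompleteSpace E] [TopologicalSpace.SeparableSpace E]
    [IsFiniteMeasure P] (hH : H ≤ mΩ) (X : Ω → Set E) : ∃ M, IsCondConvexHull H P X M := by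
  have : SecondCountableTopology E := UniformSpace.secondCountable_of_separable E
  let K : Set (Ω → Set E) := {C | IsRandomConvexClosed H P C ∧ ∀ᵐ ω ∂P, X ω ⊆ C ω}
  have hKi : ∀ {ι : Type} [Countable ι] {C : ι → Ω → Set E}, (∀ i, C i ∈ K) →
      (fun ω => ⋂ i, C i ω) ∈ K := fun hC =>
    ⟨.iInter fun i => (hC i).1, by
      filter_upwards [ae_all_iff.2 fun i => (hC i).2] with ω hω using Set.subset_iInter hω⟩
  have hKne : K.Nonempty := ⟨fun _ => Set.univ,
    ⟨by simp [IsRandomSet], by simp, by simp [convex_univ]⟩, by simp⟩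
  -- for each open set, some member of the family avoids it with the largest probability
  have key : ∀ U : Set E, IsOpen U → ∃ M ∈ K, ∀ C ∈ K, ∀ᵐ ω ∂P,
      (M ω ∩ U).Nonempty → (C ω ∩ U).Nonempty := by
    intro U hU
    let φ : (Ω → Set E) → ENNReal := fun C => P {ω | ¬(C ω ∩ U).Nonempty}
    have hφ : ∀ C D : Ω → Set E, (∀ ω, C ω ⊆ D ω) → φ D ≤ φ C := fun C D h =>
      measure_mono fun ω hω hne => hω (hne.mono (Set.inter_subset_inter_left _ (h ω)))
    obtain ⟨u, -, hu, huK⟩ := exists_seq_tendsto_sSup (hKne.image φ) (OrderTop.bddAbove _)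
    choose C hC hCu using huK
    have hM := hKi hC
    set M : Ω → Set E := fun ω => ⋂ i, C i ω
    refine ⟨M, hM, fun D hD => ?_⟩
    have hN : (fun ω => ⋂ b : Bool, (bif b then M ω else D ω)) ∈ K :=
      hKi (C := fun b ω => bif b then M ω else D ω) fun b => by cases b <;> simpa
    set N : Ω → Set E := fun ω => ⋂ b : Bool, (bif b then M ω else D ω)
    have hNM : ∀ ω, N ω ⊆ M ω := fun ω => Set.iInter_subset_of_subset true (by simp)
    have hND : ∀ ω, N ω ⊆ D ω := fun ω => Set.iInter_subset_of_subset false (by simp)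
    -- `M` lies below a maximizing sequence, so it attains the supremum of `φ`; intersecting it with
    -- `D` cannot avoid `U` on a larger event, up to null sets.
    have hle : φ N ≤ φ M := (le_sSup (Set.mem_image_of_mem φ hN)).trans
      (le_of_tendsto' hu fun n => (hCu n).symm.le.trans
        (hφ _ _ fun ω => Set.iInter_subset _ n))
    obtain ⟨A, hA, hAe⟩ := hM.1.measurable.hasMeasurableHits (P := P) hH U hU
    have hnull : NullMeasurableSet {ω | ¬(M ω ∩ U).Nonempty} P := by
      refine (hH _ hA).compl.nullMeasurableSet.congr ?_
      filter_upwards [hAe] with ω hω using propext (not_congr hω)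
    have hsub : {ω | ¬(M ω ∩ U).Nonempty} ⊆ {ω | ¬(N ω ∩ U).Nonempty} := fun ω hω hne =>
      hω (hne.mono (Set.inter_subset_inter_left _ (hNM ω)))
    filter_upwards [ae_eq_of_subset_of_measure_ge hsub hle hnull (measure_ne_top _ _)]
      with ω hω hMne
    by_contra hne
    have h1 : ¬(N ω ∩ U).Nonempty := fun h =>
      hne (h.mono (Set.inter_subset_inter_left _ (hND ω)))
    exact (iff_of_eq hω).2 h1 hMne
  let b := TopologicalSpace.countableBasis E
  have hb := TopologicalSpace.isBasis_countableBasis E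
  have hbc : Countable b := (TopologicalSpace.countable_countableBasis E).to_subtype
  choose M hMK hM using fun U : b => key U (hb.isOpen U.2)
  have hMi : (fun ω => ⋂ U, M U ω) ∈ K :=
    ⟨.iInter fun i => (hMK i).1, by
      filter_upwards [ae_all_iff.2 fun i => (hMK i).2] with ω hω using Set.subset_iInter hω⟩
  refine ⟨_, hMi.1, hMi.2, fun C hC hXC => ?_⟩
  filter_upwards [ae_all_iff.2 fun U => hM U C ⟨hC, hXC⟩, hC.closed] with ω hω hcl x hx
  rw [← hcl.closure_eq, hb.mem_closure_iff]
  intro U hU hxU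
  rw [Set.inter_comm]
  exact hω ⟨U, hU⟩ ⟨x, Set.mem_iInter.1 hx _, hxU⟩

/-- The closure of a convex-valued set-valued map with measurable hitting events is almost surely
equal to a random convex closed set. -/
theorem HasMeasurableHits.exists_isRandomConvexClosed [SecondCountableTopology E]
    {S : Ω → Set E} (hS : HasMeasurableHits H P S) (hc : ∀ᵐ ω ∂P, Convex ℝ (S ω)) :
    ∃ C, IsRandomConvexClosed H P C ∧ ∀ᵐ ω ∂P, C ω = closure (S ω) := by
  obtain ⟨C, hC, hCe⟩ := hS.exists_isRandomSet_ae_eq_closure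
  refine ⟨C, ⟨hC, ?_, ?_⟩, hCe⟩
  · filter_upwards [hCe] with ω h using h ▸ isClosed_closure
  · filter_upwards [hCe, hc] with ω h h' using h ▸ h'.closure

theorem IsCondConvexHull.ae_subset_closure_add [CompleteSpace E]
    [TopologicalSpace.SeparableSpace E] [IsFiniteMeasure P] (hH : H ≤ mΩ)
    {X Y MS C D : Ω → Set E} (hS : IsCondConvexHull H P (fun ω => X ω + Y ω) MS)
    (hC : IsRandomSet H C) (hCc : ∀ᵐ ω ∂P, Convex ℝ (C ω)) (hXC : ∀ᵐ ω ∂P, X ω ⊆ C ω)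
    (hD : IsRandomSet H D) (hDc : ∀ᵐ ω ∂P, Convex ℝ (D ω)) (hYD : ∀ᵐ ω ∂P, Y ω ⊆ D ω) :
    ∀ᵐ ω ∂P, MS ω ⊆ closure (C ω + D ω) := by
  have : SecondCountableTopology E := UniformSpace.secondCountable_of_separable E
  obtain ⟨Z, hZ, hZe⟩ := ((hC.hasMeasurableHits (P := P) hH).add
    (hD.hasMeasurableHits hH)).exists_isRandomConvexClosed (by
      filter_upwards [hCc, hDc] with ω h1 h2 using h1.add h2)
  have hsub : ∀ᵐ ω ∂P, X ω + Y ω ⊆ Z ω := by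
    filter_upwards [hZe, hXC, hYD] with ω h h1 h2
    rw [h]
    exact (Set.add_subset_add h1 h2).trans subset_closure
  filter_upwards [hS.smallest Z hZ hsub, hZe] with ω h h' using h' ▸ h

theorem IsCondConvexHull.ae_closure_add_subset [CompleteSpace E]
    [TopologicalSpace.SeparableSpace E] [IsFiniteMeasure P] (hH : H ≤ mΩ)
    {X Y MX MS : Ω → Set E} (hX : IsCondConvexHull H P X MX)
    (hS : IsCondConvexHull H P (fun ω => X ω + Y ω) MS) (hY : IsRandomSet H Y) :
    ∀ᵐ ω ∂P, closure (MX ω + Y ω) ⊆ MS ω := by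
  have : SecondCountableTopology E := UniformSpace.secondCountable_of_separable E
  obtain ⟨C, hC, hCe⟩ := (hY.hasMeasurableHits (P := P) hH).exists_isRandomSet_ae_eq_translations
    (hS.convexClosed.measurable.hasMeasurableHits hH)
  have hCe' : ∀ᵐ ω ∂P, C ω = ⋂ y ∈ Y ω, (fun x => x + y) ⁻¹' MS ω := by
    filter_upwards [hCe, hS.convexClosed.closed] with ω h hcl
    rw [h, hcl.closure_eq]
    ext x
    simp
  have hCcc : IsRandomConvexClosed H P C := by
    refine ⟨hC, ?_, ?_⟩
    · filter_upwards [hCe', hS.convexClosed.closed] with ω h hcl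
      rw [h]
      exact isClosed_biInter fun y _ => hcl.preimage (continuous_add_const y)
    · filter_upwards [hCe', hS.convexClosed.convex] with ω h hcv
      rw [h]
      exact convex_iInter₂ fun y _ => hcv.translate_preimage_left y
  have hXC : ∀ᵐ ω ∂P, X ω ⊆ C ω := by
    filter_upwards [hCe', hS.contains] with ω h hsub x hx
    rw [h]
    exact Set.mem_iInter₂.2 fun y hy => hsub (Set.add_mem_add hx hy)
  filter_upwards [hX.smallest C hCcc hXC, hCe', hS.convexClosed.closed] with ω hsub h hcl
  refine closure_minimal ?_ hcl
  rintro _ ⟨x, hx, y, hy, rfl⟩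
  have := hsub hx
  rw [h] at this
  exact Set.mem_iInter₂.1 this y hy

end Hull

theorem proposition5p4 {Ω E : Type*}
    [NormedAddCommGroup E] [NormedSpace ℝ E] [CompleteSpace E]
    [TopologicalSpace.SeparableSpace E] [MeasurableSpace E] [BorelSpace E]
    (H : MeasurableSpace Ω) [mΩ : MeasurableSpace Ω] (hH : H ≤ mΩ)
    (P : Measure Ω) [IsProbabilityMeasure P] [P.IsComplete]
    (X Y : Ω → Set E) (hX : IsRandomSet mΩ X) (hY : IsRandomSet mΩ Y) :
    -- the three conditional convex hulls exist
    (∃ MX, IsCondConvexHull H P X MX) ∧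
    (∃ MY, IsCondConvexHull H P Y MY) ∧
    (∃ MS, IsCondConvexHull H P (fun ω => X ω + Y ω) MS) ∧
    -- the inclusion, for all versions of the hulls
    (∀ MX MY MS : Ω → Set E, IsCondConvexHull H P X MX → IsCondConvexHull H P Y MY →
      IsCondConvexHull H P (fun ω => X ω + Y ω) MS →
      ∀ᵐ ω ∂P, MS ω ⊆ closure (MX ω + MY ω)) ∧
    -- the equality for an `H`-measurable convex summand
    (IsRandomSet H Y → (∀ᵐ ω ∂P, Convex ℝ (Y ω)) →
      ∀ MX MS : Ω → Set E, IsCondConvexHull H P X MX →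
        IsCondConvexHull H P (fun ω => X ω + Y ω) MS →
        ∀ᵐ ω ∂P, MS ω = closure (MX ω + Y ω)) := by
  refine ⟨exists_isCondConvexHull hH X, exists_isCondConvexHull hH Y, exists_isCondConvexHull hH _,
    fun MX MY MS hMX hMY hMS => ?_, fun hYH hYc MX MS hMX hMS => ?_⟩
  · exact hMS.ae_subset_closure_add hH hMX.convexClosed.measurable hMX.convexClosed.convex
      hMX.contains hMY.convexClosed.measurable hMY.convexClosed.convex hMY.contains
  · filter_upwards [hMS.ae_subset_closure_add hH hMX.convexClosed.measurable
      hMX.convexClosed.convex hMX.contains hYH hYc (.of_forall fun _ => subset_rfl),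
      hMX.ae_closure_add_subset hH hMS hYH] with ω h1 h2 using h1.antisymm h2
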